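/- Let $A$ be a finite alphabet and $X\subseteq A^*$. The set $X$ is complete if for every $w\in A^*$ there are $r,s\in A^*$ with $rws\in X^*$. A pair $(u,v)\in X^*\times X^*$ is a synchronizing pair of $X$ if, for all $r,s\in A^*$, $ruvs\in X^*$ implies $ru\in X^*$ and $vs\in X^*$; $X$ is synchronizing if it has a synchronizing pair. The set $X$ is a code if every word of $X^*$ factorizes uniquely as a sequence of words of $X$, and a prefix code if it is a code and no word of $X$ is a prefix of another word of $X$. Let $\ell(X)$ denote the maximal length of the words of a finite set $X$. For a class $\mathcal L$ of finite languages and integers $n,d>0$, let $C_{\mathcal L}(n,d)$ be the least positive integer $c$ such that every synchronizing set $X\in\mathcal L$ on a $d$-letter alphabet with $\ell(X)\le n$ has a synchronizing pair $(u,v)$ with $|uv|\le c$. Let $\mathcal L$ be the class of finite complete languages, or the class of finite complete codes, or the class of finite complete prefix codes. Then, for all integers $n\ge 1$ and $d\ge 3$, \[ C_{\mathcal L}(n,d)\le\left\lceil\frac{C_{\mathcal L}(\lceil\log_2(d+1)\rceil\, n,\,2)}{\lfloor\log_2(d-1)\rfloor}\right\rceil . \] -/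

import Mathlib

open scoped Computability

/-- `(r, s)` is an `X`-completion of the word `w` if `r w s ∈ X*`. -/
def IsCompletion {A : Type} (X : Language A) (r s w : List A) : Prop :=
  r ++ w ++ s ∈ X∗

/-- `X` is complete if every word over the alphabet has an `X`-completion. -/
def IsCompleteSet {A : Type} (X : Language A) : Prop :=
  ∀ w : List A, ∃ r s : List A, IsCompletion X r s w

/-- `(u, v) ∈ X* × X*` is a synchronizing pair of `X` if `r u, v s ∈ X*` for every
`X`-completion `(r, s)` of `u v`. -/
def IsSyncPair {A : Type} (X : Language A) (u v : List A) : Prop :=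
  u ∈ X∗ ∧ v ∈ X∗ ∧
    ∀ r s : List A, IsCompletion X r s (u ++ v) → r ++ u ∈ X∗ ∧ v ++ s ∈ X∗

/-- `X` is synchronizing if it has a synchronizing pair. -/
def IsSynchronizing {A : Type} (X : Language A) : Prop :=
  ∃ u v : List A, IsSyncPair X u v

/-- `X` is a (variable length) code: every word of `X*` has a unique factorization
as a sequence of words of `X`. -/
def IsCode {A : Type} (X : Language A) : Prop :=
  InformationTheory.UniquelyDecodable (X : Set (List A))

/-- `X` is a prefix set: no word of `X` is a prefix of another word of `X`. -/
def IsPrefixSet {A : Type} (X : Language A) : Prop :=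
  ∀ x ∈ X, ∀ y ∈ X, x <+: y → x = y

/-- `X` is a prefix code: a code that is a prefix set. -/
def IsPrefixCode {A : Type} (X : Language A) : Prop :=
  IsCode X ∧ IsPrefixSet X

/-- The size `ℓ(X)`: the maximal length of the words of `X`
(`0` for the empty set, `⊤` for a set of unbounded length). -/
noncomputable def langSize {A : Type} (X : Language A) : ℕ∞ :=
  ⨆ w ∈ X, (w.length : ℕ∞)

/-- A class of languages: a set of languages over each alphabet. -/
abbrev LanguageClass : Type 1 := (A : Type) → Set (Language A)

/-- The class of finite complete languages. -/
def finiteCompleteLanguages : LanguageClass := fun A =>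
  {X : Language A | Set.Finite (X : Set (List A)) ∧ IsCompleteSet X}

/-- The class of finite complete codes. -/
def finiteCompleteCodes : LanguageClass := fun A =>
  {X : Language A | Set.Finite (X : Set (List A)) ∧ IsCompleteSet X ∧ IsCode X}

/-- The class of finite complete prefix codes. -/
def finiteCompletePrefixCodes : LanguageClass := fun A =>
  {X : Language A | Set.Finite (X : Set (List A)) ∧ IsCompleteSet X ∧ IsPrefixCode X}

/-- `c` is a positive integer such that every synchronizing set of the class `L` over the
`d`-letter alphabet `Fin d` with size at most `n` has a synchronizing pair `(u, v)` with
`|u v| ≤ c`. -/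
def IsSyncBound (L : LanguageClass) (n d c : ℕ) : Prop :=
  0 < c ∧ ∀ X : Language (Fin d), X ∈ L (Fin d) → IsSynchronizing X → langSize X ≤ n →
    ∃ u v : List (Fin d), IsSyncPair X u v ∧ (u ++ v).length ≤ c

/-- `C_L(n, d)`: the least positive integer `c` as in `IsSyncBound`. -/
noncomputable def syncC (L : LanguageClass) (n d : ℕ) : ℕ :=
  sInf {c : ℕ | IsSyncBound L n d c}

theorem langSize_le_iff {A : Type} (X : Language A) (n : ℕ) :
    langSize X ≤ n ↔ ∀ w ∈ X, w.length ≤ n := by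
  simp [langSize, iSup_le_iff]

/-- The least positive integer in the definition of `syncC` always exists. -/
theorem syncC_isLeast (L : LanguageClass) (n d : ℕ) :
    IsLeast {c : ℕ | IsSyncBound L n d c} (syncC L n d) := by
  classical
  suffices h : {c : ℕ | IsSyncBound L n d c}.Nonempty from
    ⟨Nat.sInf_mem h, fun c hc => Nat.sInf_le hc⟩
  have hfin : {X : Set (List (Fin d)) | X ⊆ {w | w.length ≤ n}}.Finite :=
    (List.finite_length_le (Fin d) n).finite_subsets
  have hex : ∀ X : Language (Fin d), ∃ c : ℕ, IsSynchronizing X →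
      ∃ u v : List (Fin d), IsSyncPair X u v ∧ (u ++ v).length ≤ c := by
    intro X
    by_cases hX : IsSynchronizing X
    · obtain ⟨u, v, huv⟩ := hX
      exact ⟨(u ++ v).length, fun _ => ⟨u, v, huv, le_rfl⟩⟩
    · exact ⟨0, fun h => absurd h hX⟩
  choose f hf using hex
  obtain ⟨b, hb⟩ := (hfin.image f).bddAbove
  refine ⟨b + 1, Nat.succ_pos b, fun X _ hs hn => ?_⟩
  obtain ⟨u, v, huv, hlen⟩ := hf X hs
  have hle : f X ≤ b := hb ⟨X, fun w hw => (langSize_le_iff X n).1 hn w hw, rfl⟩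
  exact ⟨u, v, huv, by omega⟩

/-! Encode the `d` letters by a binary maximal prefix code `Z` with `d` words, each of length
between `⌊log₂(d-1)⌋` and `⌈log₂(d+1)⌉`. The encoded set stays in the class; its size grows at most
by the upper length. Its synchronizing pairs decode to pairs of `X` (`exists_isSyncPair`), and
decoding divides lengths by at least the lower bound.

The delicate point is that the encoded set must be synchronizing (`isSynchronizing_encode`). A
binary context may cut through a codeword, so `Z` needs a word `t` with `r ++ t ∈ Z*` for every `r`.
To build `t`, think of the decoder whose states are the proper prefixes of `Z`, with root the empty
word. A long run of zeros forces a state `0^j` with `j < p`, where `0^p ∈ Z`. It remains to find one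
word taking all these states to the root, and `Z` is chosen so that a suitable `w` shifts each `0^j`
with `j ≥ 1` to `0^(j+1)` or to `0^(j-1)`.

If `d` is not a power of 2, words of two consecutive lengths suffice. If `d` is a power of 2, the
uniform code has no reset word and three lengths are used; this is why `d-1` and `d+1` occur in the
bounds. -/

namespace PrefixEncoding

/-! ### Transfer of language properties along a prefix encoding -/

section Encoding

variable {A B : Type}

/-- The image of a language under the morphism of free monoids extending `φ`. -/
def encode (φ : A → List B) (X : Language A) : Language B :=
  (fun w : List A => w.flatMap φ) '' (X : Set (List A))

theorem append_mem_kstar {X : Language A} {u v : List A} (hu : u ∈ X∗) (hv : v ∈ X∗) :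
    u ++ v ∈ X∗ := by
  obtain ⟨L, rfl, hL⟩ := Language.mem_kstar.1 hu
  obtain ⟨K, rfl, hK⟩ := Language.mem_kstar.1 hv
  refine Language.mem_kstar.2 ⟨L ++ K, by simp, fun y hy => ?_⟩
  rcases List.mem_append.1 hy with h | h
  exacts [hL y h, hK y h]

theorem mem_kstar_of_mem {X : Language A} {u : List A} (hu : u ∈ X) : u ∈ X∗ :=
  Language.mem_kstar.2 ⟨[u], by simp, by simpa using hu⟩

theorem flatten_map_flatMap (φ : A → List B) (L : List (List A)) :
    (L.map (fun w => w.flatMap φ)).flatten = L.flatten.flatMap φ := by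
  induction L with
  | nil => simp
  | cons a L ih => simp [ih]

theorem exists_map_of_forall_mem_encode {φ : A → List B} {X : Language A} {K : List (List B)}
    (hK : ∀ y ∈ K, y ∈ encode φ X) :
    ∃ L : List (List A), (∀ y ∈ L, y ∈ X) ∧ K = L.map (fun w => w.flatMap φ) := by
  induction K with
  | nil => exact ⟨[], by simp, rfl⟩
  | cons y K ih =>
    obtain ⟨L, hL, rfl⟩ := ih fun z hz => hK z (List.mem_cons_of_mem _ hz)
    obtain ⟨x, hx, rfl⟩ := hK y List.mem_cons_self
    refine ⟨x :: L, fun z hz => ?_, rfl⟩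
    rcases List.mem_cons.1 hz with rfl | h
    exacts [hx, hL z h]

theorem mem_kstar_encode {φ : A → List B} {X : Language A} {y : List B} :
    y ∈ (encode φ X)∗ ↔ ∃ w ∈ X∗, w.flatMap φ = y := by
  constructor
  · intro hy
    obtain ⟨K, rfl, hK⟩ := Language.mem_kstar.1 hy
    obtain ⟨L, hL, rfl⟩ := exists_map_of_forall_mem_encode hK
    exact ⟨L.flatten, Language.mem_kstar.2 ⟨L, rfl, hL⟩, (flatten_map_flatMap φ L).symm⟩
  · rintro ⟨w, hw, rfl⟩
    obtain ⟨L, rfl, hL⟩ := Language.mem_kstar.1 hw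
    refine Language.mem_kstar.2 ⟨L.map (fun w => w.flatMap φ), (flatten_map_flatMap φ L).symm, ?_⟩
    intro y hy
    obtain ⟨x, hx, rfl⟩ := List.mem_map.1 hy
    exact ⟨x, hL x hx, rfl⟩

/-- `φ` enumerates a prefix code. -/
structure IsPrefixEncoding (φ : A → List B) : Prop where
  eq_of_prefix : ∀ a b, φ a <+: φ b → a = b
  ne_nil : ∀ a, φ a ≠ []

/-- Every word over `B` is a prefix of an encoded word. -/
def IsRightComplete (φ : A → List B) : Prop :=
  ∀ w : List B, ∃ (s : List B) (t : List A), w ++ s = t.flatMap φ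

/-- Some encoded word resets the decoder: whatever is read before it, the whole is encoded. -/
def HasResetWord (φ : A → List B) : Prop :=
  ∃ t : List A, ∀ r : List B, ∃ t' : List A, r ++ t.flatMap φ = t'.flatMap φ

variable {φ : A → List B}

/-- The first codeword is forced by comparability, so an encoded prefix can be cancelled inside the
encoded words. All decoding steps rest on this. -/
theorem IsPrefixEncoding.exists_of_append_eq (hφ : IsPrefixEncoding φ) {u w : List A} {s : List B}
    (h : u.flatMap φ ++ s = w.flatMap φ) : ∃ s', w = u ++ s' ∧ s = s'.flatMap φ := by
  induction u generalizing w with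
  | nil => exact ⟨w, rfl, by simpa using h⟩
  | cons a u ih =>
    cases w with
    | nil =>
      have := hφ.ne_nil a
      simp_all
    | cons b w =>
      simp only [List.flatMap_cons, List.append_assoc] at h
      have hab : a = b := by
        have h1 : φ a <+: φ b ++ w.flatMap φ := ⟨_, h⟩
        rcases List.prefix_or_prefix_of_prefix h1 (List.prefix_append _ _) with h' | h'
        · exact hφ.eq_of_prefix _ _ h'
        · exact (hφ.eq_of_prefix _ _ h').symm
      subst hab
      obtain ⟨s', rfl, rfl⟩ := ih (List.append_cancel_left h)
      exact ⟨s', rfl, rfl⟩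

theorem IsPrefixEncoding.flatMap_injective (hφ : IsPrefixEncoding φ) :
    Function.Injective (fun w : List A => w.flatMap φ) := by
  intro u w h
  obtain ⟨s', rfl, hs⟩ := hφ.exists_of_append_eq (u := u) (w := w) (s := []) (by simpa using h)
  cases s' with
  | nil => simp
  | cons a s' =>
    have := hφ.ne_nil a
    simp_all

theorem IsPrefixEncoding.flatMap_mem_kstar_encode (hφ : IsPrefixEncoding φ) {X : Language A}
    {w : List A} : w.flatMap φ ∈ (encode φ X)∗ ↔ w ∈ X∗ := by
  rw [mem_kstar_encode]
  constructor
  · rintro ⟨v, hv, h⟩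
    exact hφ.flatMap_injective h ▸ hv
  · exact fun hw => ⟨w, hw, rfl⟩

theorem isCompleteSet_encode (hc : IsRightComplete φ) {X : Language A} (hX : IsCompleteSet X) :
    IsCompleteSet (encode φ X) := by
  intro w
  obtain ⟨s, t, hst⟩ := hc w
  obtain ⟨r', s', h⟩ := hX t
  refine ⟨r'.flatMap φ, s ++ s'.flatMap φ, mem_kstar_encode.2 ⟨_, h, ?_⟩⟩
  simp [← hst]

theorem IsPrefixEncoding.isCode_encode (hφ : IsPrefixEncoding φ) {X : Language A}
    (hX : IsCode X) : IsCode (encode φ X) := by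
  intro K₁ K₂ h₁ h₂ h
  obtain ⟨L₁, hL₁, rfl⟩ := exists_map_of_forall_mem_encode h₁
  obtain ⟨L₂, hL₂, rfl⟩ := exists_map_of_forall_mem_encode h₂
  rw [flatten_map_flatMap, flatten_map_flatMap] at h
  rw [hX L₁ L₂ hL₁ hL₂ (hφ.flatMap_injective h)]

theorem IsPrefixEncoding.isPrefixSet_encode (hφ : IsPrefixEncoding φ) {X : Language A}
    (hX : IsPrefixSet X) : IsPrefixSet (encode φ X) := by
  rintro _ ⟨x, hx, rfl⟩ _ ⟨y, hy, rfl⟩ ⟨s, hs⟩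
  obtain ⟨s', rfl, -⟩ := hφ.exists_of_append_eq hs
  exact congrArg (fun w : List A => w.flatMap φ) (hX x hx _ hy (List.prefix_append _ _))

theorem finite_encode {X : Language A} (hX : Set.Finite (X : Set (List A))) :
    Set.Finite (encode φ X : Set (List B)) :=
  hX.image _

theorem length_flatMap_le {N : ℕ} (hN : ∀ a, (φ a).length ≤ N) (w : List A) :
    (w.flatMap φ).length ≤ N * w.length := by
  induction w with
  | nil => simp
  | cons a w ih =>
    have := hN a
    simp only [List.flatMap_cons, List.length_append, List.length_cons, mul_add, mul_one]
    omega

theorem le_length_flatMap {N : ℕ} (hN : ∀ a, N ≤ (φ a).length) (w : List A) :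
    N * w.length ≤ (w.flatMap φ).length := by
  induction w with
  | nil => simp
  | cons a w ih =>
    have := hN a
    simp only [List.flatMap_cons, List.length_append, List.length_cons, mul_add, mul_one]
    omega

theorem langSize_encode_le {N n : ℕ} (hN : ∀ a, (φ a).length ≤ N) {X : Language A}
    (hX : langSize X ≤ n) : langSize (encode φ X) ≤ (N * n : ℕ) := by
  rw [langSize_le_iff] at hX ⊢
  rintro _ ⟨w, hw, rfl⟩
  exact (length_flatMap_le hN w).trans (Nat.mul_le_mul_left N (hX w hw))

/-- A synchronizing pair of `X` only controls encoded contexts, so its left component is preceded by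
a reset word. The reset word `t` need not lie in `X∗`; completeness embeds it in `r₀ ++ t ++ s₀ ∈
X∗`. -/
theorem IsPrefixEncoding.isSynchronizing_encode (hφ : IsPrefixEncoding φ) (hr : HasResetWord φ)
    {X : Language A} (hX : IsCompleteSet X) (hs : IsSynchronizing X) :
    IsSynchronizing (encode φ X) := by
  obtain ⟨u, v, hu, hv, huv⟩ := hs
  obtain ⟨t, ht⟩ := hr
  obtain ⟨r₀, s₀, hp⟩ := hX t
  refine ⟨(r₀ ++ t ++ s₀ ++ u).flatMap φ, v.flatMap φ,
    hφ.flatMap_mem_kstar_encode.2 (append_mem_kstar hp hu), hφ.flatMap_mem_kstar_encode.2 hv, ?_⟩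
  intro r s hrs
  obtain ⟨t', ht'⟩ := ht (r ++ r₀.flatMap φ)
  have key : r ++ (r₀ ++ t ++ s₀ ++ u).flatMap φ = (t' ++ s₀ ++ u).flatMap φ := by
    simp only [List.flatMap_append, ← ht', List.append_assoc]
  have hrs' : (t' ++ s₀ ++ u ++ v).flatMap φ ++ s ∈ (encode φ X)∗ := by
    have : (t' ++ s₀ ++ u ++ v).flatMap φ ++ s =
        r ++ ((r₀ ++ t ++ s₀ ++ u).flatMap φ ++ v.flatMap φ) ++ s := by
      rw [List.flatMap_append, ← key]
      simp only [List.append_assoc]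
    rw [this]
    exact hrs
  obtain ⟨w, hw, hweq⟩ := mem_kstar_encode.1 hrs'
  -- Once the left part is encoded, prefix decoding forces the right context `s` to be encoded too.
  obtain ⟨s', rfl, rfl⟩ := hφ.exists_of_append_eq hweq.symm
  obtain ⟨h1, h2⟩ := huv (t' ++ s₀) s' (by
    simpa only [IsCompletion, List.append_assoc] using hw)
  rw [key, ← List.flatMap_append]
  exact ⟨hφ.flatMap_mem_kstar_encode.2 h1, hφ.flatMap_mem_kstar_encode.2 h2⟩

theorem IsPrefixEncoding.exists_isSyncPair (hφ : IsPrefixEncoding φ) {X : Language A}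
    {u v : List B} (h : IsSyncPair (encode φ X) u v) :
    ∃ u' v' : List A, IsSyncPair X u' v' ∧ u'.flatMap φ = u ∧ v'.flatMap φ = v := by
  obtain ⟨hu, hv, huv⟩ := h
  obtain ⟨u', hu', rfl⟩ := mem_kstar_encode.1 hu
  obtain ⟨v', hv', rfl⟩ := mem_kstar_encode.1 hv
  refine ⟨u', v', ⟨hu', hv', fun r s hrs => ?_⟩, rfl, rfl⟩
  obtain ⟨h1, h2⟩ := huv (r.flatMap φ) (s.flatMap φ) (by
    simpa only [IsCompletion, List.flatMap_append] using hφ.flatMap_mem_kstar_encode.2 hrs)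
  rw [← List.flatMap_append] at h1 h2
  exact ⟨hφ.flatMap_mem_kstar_encode.1 h1, hφ.flatMap_mem_kstar_encode.1 h2⟩

theorem IsPrefixEncoding.encode_mem_class (hφ : IsPrefixEncoding φ) (hc : IsRightComplete φ)
    {L : LanguageClass}
    (hL : L = finiteCompleteLanguages ∨ L = finiteCompleteCodes ∨ L = finiteCompletePrefixCodes)
    {X : Language A} (hX : X ∈ L A) : IsCompleteSet X ∧ encode φ X ∈ L B := by
  rcases hL with rfl | rfl | rfl
  · exact ⟨hX.2, finite_encode hX.1, isCompleteSet_encode hc hX.2⟩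
  · exact ⟨hX.2.1, finite_encode hX.1, isCompleteSet_encode hc hX.2.1, hφ.isCode_encode hX.2.2⟩
  · exact ⟨hX.2.1, finite_encode hX.1, isCompleteSet_encode hc hX.2.1,
      hφ.isCode_encode hX.2.2.1, hφ.isPrefixSet_encode hX.2.2.2⟩

end Encoding

/-! ### Binary maximal prefix codes and leaf splitting -/

section MaximalPrefixCodes

open Finset

/-- A finite maximal prefix code: distinct words of `Z` are incomparable for the prefix order,
and every word is comparable with a word of `Z`. -/
structure IsMaximalPrefixCode (Z : Finset (List (Fin 2))) : Prop where
  eq_of_prefix : ∀ x ∈ Z, ∀ y ∈ Z, x <+: y → x = y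
  exists_comparable : ∀ w : List (Fin 2), ∃ z ∈ Z, w <+: z ∨ z <+: w

/-- Replace each word `t ∈ T` of `Z` by its two extensions by one letter. -/
def split (Z T : Finset (List (Fin 2))) : Finset (List (Fin 2)) :=
  (Z \ T) ∪ (T ×ˢ (univ : Finset (Fin 2))).image (fun q => q.1 ++ [q.2])

theorem mem_split {Z T : Finset (List (Fin 2))} {w : List (Fin 2)} :
    w ∈ split Z T ↔ (w ∈ Z ∧ w ∉ T) ∨ ∃ t ∈ T, ∃ b, t ++ [b] = w := by
  simp only [split, mem_union, mem_sdiff, mem_image, mem_product, mem_univ, and_true, Prod.exists]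
  constructor
  · rintro (h | ⟨t, b, h, rfl⟩)
    exacts [Or.inl h, Or.inr ⟨t, h, b, rfl⟩]
  · rintro (h | ⟨t, h, b, rfl⟩)
    exacts [Or.inl h, Or.inr ⟨t, b, h, rfl⟩]

theorem IsMaximalPrefixCode.split {Z T : Finset (List (Fin 2))} (hZ : IsMaximalPrefixCode Z)
    (hT : T ⊆ Z) : IsMaximalPrefixCode (split Z T) := by
  constructor
  · intro x hx y hy hxy
    rcases mem_split.1 hx with ⟨hx, hxT⟩ | ⟨t, ht, b, rfl⟩ <;>
      rcases mem_split.1 hy with ⟨hy, hyT⟩ | ⟨t', ht', b', rfl⟩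
    · exact hZ.eq_of_prefix x hx y hy hxy
    · rcases List.prefix_concat_iff.1 hxy with h | h
      · exact h
      · exact absurd (hZ.eq_of_prefix x hx t' (hT ht') h ▸ ht') hxT
    · have := hZ.eq_of_prefix t (hT ht) y hy ((List.prefix_append _ _).trans hxy)
      exact absurd (this ▸ ht) hyT
    · rcases List.prefix_concat_iff.1 hxy with h | h
      · exact h
      · have := hZ.eq_of_prefix t (hT ht) t' (hT ht') ((List.prefix_append _ _).trans h)
        subst this
        have := h.length_le
        simp at this
  · intro w
    obtain ⟨z, hz, h⟩ := hZ.exists_comparable w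
    by_cases hzT : z ∈ T
    · have hmem : ∀ b, z ++ [b] ∈ PrefixEncoding.split Z T := fun b =>
        mem_split.2 (Or.inr ⟨z, hzT, b, rfl⟩)
      rcases h with h | ⟨s, rfl⟩
      · exact ⟨z ++ [0], hmem 0, Or.inl (h.trans (List.prefix_append _ _))⟩
      · cases s with
        | nil => exact ⟨z ++ [0], hmem 0, Or.inl (by simp)⟩
        | cons b s => exact ⟨z ++ [b], hmem b, Or.inr ⟨s, by simp⟩⟩
    · exact ⟨z, mem_split.2 (Or.inl ⟨hz, hzT⟩), h⟩

theorem IsMaximalPrefixCode.card_split {Z T : Finset (List (Fin 2))} (hZ : IsMaximalPrefixCode Z)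
    (hT : T ⊆ Z) : (PrefixEncoding.split Z T).card = Z.card + T.card := by
  rw [PrefixEncoding.split, card_union_of_disjoint, card_sdiff_of_subset hT,
    card_image_of_injOn, card_product]
  · have := card_le_card hT
    simp
    omega
  · rintro ⟨t, b⟩ - ⟨t', b'⟩ - h
    obtain ⟨h1, h2⟩ := List.append_inj' h rfl
    simp_all
  · rw [Finset.disjoint_left]
    intro w hw hw'
    obtain ⟨⟨t, b⟩, htb, rfl⟩ := mem_image.1 hw'
    have ht := (mem_product.1 htb).1
    have hw := (mem_sdiff.1 hw).1
    have := congrArg List.length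
      (hZ.eq_of_prefix t (hT ht) _ hw (List.prefix_append t [b]))
    simp at this

/-- All binary words of length `k`. -/
def wordsOfLength : ℕ → Finset (List (Fin 2))
  | 0 => {[]}
  | k + 1 => split (wordsOfLength k) (wordsOfLength k)

theorem mem_wordsOfLength {k : ℕ} {w : List (Fin 2)} : w ∈ wordsOfLength k ↔ w.length = k := by
  induction k generalizing w with
  | zero => simp [wordsOfLength]
  | succ k ih =>
    rw [wordsOfLength, mem_split]
    constructor
    · rintro (h | ⟨t, ht, b, rfl⟩)
      · exact absurd h.1 h.2
      · simp [ih.1 ht]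
    · intro h
      right
      obtain rfl | ⟨t, b, rfl⟩ := w.eq_nil_or_concat'
      · simp at h
      · exact ⟨t, ih.2 (by simpa using h), b, rfl⟩

theorem isMaximalPrefixCode_wordsOfLength (k : ℕ) : IsMaximalPrefixCode (wordsOfLength k) := by
  induction k with
  | zero => exact ⟨by simp [wordsOfLength], by simp [wordsOfLength]⟩
  | succ k ih => exact ih.split subset_rfl

theorem card_wordsOfLength (k : ℕ) : (wordsOfLength k).card = 2 ^ k := by
  induction k with
  | zero => simp [wordsOfLength]
  | succ k ih =>
    rw [wordsOfLength, (isMaximalPrefixCode_wordsOfLength k).card_split subset_rfl, ih]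
    ring

/-! ### Decoding and reset words -/

/-- The submonoid generated by `Z`, as a language. -/
abbrev star (Z : Finset (List (Fin 2))) : Language (Fin 2) :=
  ((Z : Set (List (Fin 2))) : Language (Fin 2))∗

theorem mem_star_of_mem {Z : Finset (List (Fin 2))} {z : List (Fin 2)} (hz : z ∈ Z) :
    z ∈ star Z :=
  mem_kstar_of_mem (X := ((Z : Set (List (Fin 2))) : Language (Fin 2))) (mem_coe.2 hz)

/-- Codewords are peeled off greedily; the rest `q`, a prefix of a codeword, is the state of the
decoder after reading `w`. -/
theorem IsMaximalPrefixCode.exists_factorization {Z : Finset (List (Fin 2))}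
    (hZ : IsMaximalPrefixCode Z) (hne : [] ∉ Z) (w : List (Fin 2)) :
    ∃ z ∈ star Z, ∃ q, w = z ++ q ∧ ∃ y ∈ Z, q <+: y := by
  induction hn : w.length using Nat.strong_induction_on generalizing w with
  | _ n ih =>
    obtain ⟨z, hz, h | ⟨s, rfl⟩⟩ := hZ.exists_comparable w
    · exact ⟨[], Language.nil_mem_kstar _, w, rfl, z, hz, h⟩
    · have hpos : 0 < z.length := List.length_pos_iff.2 fun h => hne (h ▸ hz)
      obtain ⟨x, hx, q, rfl, hq⟩ := ih s.length (by simp at hn; omega) s rfl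
      exact ⟨z ++ x, append_mem_kstar (mem_star_of_mem hz) hx, q, by simp, hq⟩

theorem IsMaximalPrefixCode.exists_append_mem_star {Z : Finset (List (Fin 2))}
    (hZ : IsMaximalPrefixCode Z) (hne : [] ∉ Z) (w : List (Fin 2)) : ∃ s, w ++ s ∈ star Z := by
  obtain ⟨z, hz, q, rfl, y, hy, s, rfl⟩ := hZ.exists_factorization hne w
  exact ⟨s, by simpa using append_mem_kstar hz (mem_star_of_mem hy)⟩

/-- The word `0 ^ j`. -/
abbrev zeros (j : ℕ) : List (Fin 2) := List.replicate j 0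

theorem zeros_append (i j : ℕ) : zeros i ++ zeros j = zeros (i + j) :=
  List.replicate_append_replicate

theorem zeros_mul_mem_star {Z : Finset (List (Fin 2))} {p : ℕ} (hp : zeros p ∈ star Z) (m : ℕ) :
    zeros (m * p) ∈ star Z := by
  induction m with
  | zero => simpa using Language.nil_mem_kstar _
  | succ m ih =>
    rw [add_mul, one_mul, ← zeros_append]
    exact append_mem_kstar ih hp

/-- A word that leads from every state on the cycle of zeros back to the root yields a
reset word. -/
theorem IsMaximalPrefixCode.exists_reset {Z : Finset (List (Fin 2))}
    (hZ : IsMaximalPrefixCode Z) (hne : [] ∉ Z) {p : ℕ} (hp0 : 0 < p) (hp : zeros p ∈ star Z)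
    {x : List (Fin 2)} (hx : ∀ j < p, zeros j ++ x ∈ star Z) :
    ∃ t ∈ star Z, ∀ r, r ++ t ∈ star Z := by
  obtain ⟨N, hN⟩ : ∃ N, ∀ z ∈ Z, z.length ≤ N :=
    ⟨Z.sup List.length, fun z hz => le_sup (f := List.length) hz⟩
  refine ⟨zeros (N * p) ++ x,
    append_mem_kstar (zeros_mul_mem_star hp N) (by simpa using hx 0 hp0), fun r => ?_⟩
  obtain ⟨z, hz, q, hzq, y, hy, hqy⟩ := hZ.exists_factorization hne (r ++ zeros (N * p))
  -- The undecoded rest is no longer than a codeword, so it lies within the run of zeros and is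
  -- determined by its length; modulo `0^p` only `j < p` matters.
  have hlen : q.length ≤ (zeros (N * p)).length := by
    have h1 := hqy.length_le
    have h2 := hN y hy
    have h3 := Nat.le_mul_of_pos_right N hp0
    simp only [zeros, List.length_replicate]
    omega
  have hsuf : q <:+ zeros (N * p) :=
    List.suffix_of_suffix_length_le (hzq ▸ List.suffix_append z q) (List.suffix_append r _) hlen
  have hq : q = zeros (q.length / p * p) ++ zeros (q.length % p) := by
    rw [zeros_append, mul_comm, Nat.div_add_mod]
    exact List.eq_replicate_iff.2 ⟨rfl, fun b hb => List.eq_of_mem_replicate (hsuf.subset hb)⟩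
  rw [← List.append_assoc, hzq, hq, List.append_assoc, List.append_assoc]
  exact append_mem_kstar hz (append_mem_kstar (zeros_mul_mem_star hp _)
    (hx _ (Nat.mod_lt _ hp0)))

/-- Reading `w` fixes the root and moves `0^j` to `0^(j+1)`, while `0^p` is the root. Hence `w^p`
takes every `0^j` to the root. -/
theorem exists_of_shift_up {Z : Finset (List (Fin 2))} {p : ℕ} (hp : zeros p ∈ star Z)
    {w : List (Fin 2)} (hw : w ∈ star Z)
    (hs : ∀ j, 1 ≤ j → j < p → ∃ z ∈ star Z, zeros j ++ w = z ++ zeros (j + 1)) :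
    ∃ x, ∀ j < p, zeros j ++ x ∈ star Z := by
  have hpow : ∀ i, (List.replicate i w).flatten ∈ star Z := by
    intro i
    induction i with
    | zero => simpa using Language.nil_mem_kstar _
    | succ i ih => simpa [List.replicate_succ] using append_mem_kstar hw ih
  have key : ∀ i j, 1 ≤ j → j ≤ p → p ≤ i + j →
      zeros j ++ (List.replicate i w).flatten ∈ star Z := by
    intro i
    induction i with
    | zero =>
      intro j _ h1 h2
      obtain rfl : j = p := by omega
      simpa using hp
    | succ i ih =>
      intro j h0 h1 h2
      rcases h1.eq_or_lt with rfl | h1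
      · exact append_mem_kstar hp (hpow _)
      · obtain ⟨z, hz, h⟩ := hs j h0 h1
        rw [List.replicate_succ, List.flatten_cons, ← List.append_assoc, h, List.append_assoc]
        exact append_mem_kstar hz (ih (j + 1) (by omega) h1 (by omega))
  refine ⟨(List.replicate p w).flatten, fun j hj => ?_⟩
  rcases Nat.eq_zero_or_pos j with rfl | h0
  · simpa using hpow p
  · exact key p j h0 hj.le (by omega)

/-- Here `w` moves `0^j` down to `0^(j-1)`, so `j` readings of `w` reach the root, which `w` then
fixes. -/
theorem exists_of_shift_down {Z : Finset (List (Fin 2))} {p : ℕ}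
    {w : List (Fin 2)} (hw : w ∈ star Z)
    (hs : ∀ j, 1 ≤ j → j < p → ∃ z ∈ star Z, zeros j ++ w = z ++ zeros (j - 1)) :
    ∃ x, ∀ j < p, zeros j ++ x ∈ star Z := by
  have key : ∀ i j, j ≤ i → j < p → zeros j ++ (List.replicate i w).flatten ∈ star Z := by
    intro i
    induction i with
    | zero =>
      intro j h1 _
      obtain rfl : j = 0 := by omega
      simpa using Language.nil_mem_kstar _
    | succ i ih =>
      intro j h1 h2
      rw [List.replicate_succ, List.flatten_cons, ← List.append_assoc]
      rcases Nat.eq_zero_or_pos j with rfl | h0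
      · simpa using append_mem_kstar hw (by simpa using ih 0 (by omega) h2)
      · obtain ⟨z, hz, h⟩ := hs j h0 h2
        rw [h, List.append_assoc]
        exact append_mem_kstar hz (ih (j - 1) (by omega) (by omega))
  exact ⟨(List.replicate p w).flatten, fun j hj => key p j hj.le hj⟩

/-- The word `0 ^ i 1 0 ^ j`. -/
def zerosOneZeros (i j : ℕ) : List (Fin 2) := zeros i ++ 1 :: zeros j

theorem length_zerosOneZeros (i j : ℕ) : (zerosOneZeros i j).length = i + j + 1 := by
  simp [zerosOneZeros]
  omega

theorem zerosOneZeros_append_zeros (i j l : ℕ) :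
    zerosOneZeros i j ++ zeros l = zerosOneZeros i (j + l) := by
  simp [zerosOneZeros, zeros]

theorem zeros_append_zerosOneZeros (i j l : ℕ) :
    zeros l ++ zerosOneZeros i j = zerosOneZeros (l + i) j := by
  simp [zerosOneZeros, zeros, ← List.append_assoc]

theorem zeros_ne_zerosOneZeros (i j l : ℕ) : zeros l ≠ zerosOneZeros i j := by
  intro h
  have : (1 : Fin 2) ∈ zeros l := by
    rw [h]
    simp [zerosOneZeros]
  exact absurd (List.eq_of_mem_replicate this) (by decide)

theorem zerosOneZeros_zero_ne {i j l : ℕ} (hi : 1 ≤ i) :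
    zerosOneZeros 0 l ≠ zerosOneZeros i j := by
  obtain ⟨i, rfl⟩ := Nat.exists_eq_add_of_le' hi
  intro h
  simp [zerosOneZeros, zeros, List.replicate_succ] at h

/-- If reading `0` repeatedly has period `p` and `1 0 ^ l`, `0 ^ j 1 0 ^ (l - 1 - j)`
are code words for `0 < j < p ≤ l`, there is a reset word. -/
theorem IsMaximalPrefixCode.exists_reset_of_long {Z : Finset (List (Fin 2))}
    (hZ : IsMaximalPrefixCode Z) (hne : [] ∉ Z) {p l : ℕ} (hp0 : 0 < p) (hpl : p ≤ l)
    (hp : zeros p ∈ Z) (h0 : zerosOneZeros 0 l ∈ Z)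
    (hj : ∀ j, 1 ≤ j → j < p → zerosOneZeros j (l - 1 - j) ∈ Z) :
    ∃ t ∈ star Z, ∀ r, r ++ t ∈ star Z := by
  -- With `w = 1 0^l`, the word `0^j w` is the codeword `0^j 1 0^(l-1-j)` followed by `0^(j+1)`.
  obtain ⟨x, hx⟩ := exists_of_shift_up (mem_star_of_mem hp) (mem_star_of_mem h0)
    fun j h1 h2 => ⟨_, mem_star_of_mem (hj j h1 h2), by
      rw [zeros_append_zerosOneZeros, zerosOneZeros_append_zeros]
      congr 1
      omega⟩
  exact hZ.exists_reset hne hp0 (mem_star_of_mem hp) hx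

/-- If `0 ^ (k + 1)`, `1 0 ^ (k - 1)` and `0 ^ j 1 0 ^ (k - j)` are code words for `0 < j ≤ k`,
there is a reset word. -/
theorem IsMaximalPrefixCode.exists_reset_of_short {Z : Finset (List (Fin 2))}
    (hZ : IsMaximalPrefixCode Z) (hne : [] ∉ Z) {k : ℕ} (hk : 0 < k)
    (hp : zeros (k + 1) ∈ Z) (h0 : zerosOneZeros 0 (k - 1) ∈ Z)
    (hj : ∀ j, 1 ≤ j → j ≤ k → zerosOneZeros j (k - j) ∈ Z) :
    ∃ t ∈ star Z, ∀ r, r ++ t ∈ star Z := by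
  have hw : zerosOneZeros 0 (2 * k) ∈ star Z := by
    have : zerosOneZeros 0 (2 * k) = zerosOneZeros 0 (k - 1) ++ zeros (k + 1) := by
      rw [zerosOneZeros_append_zeros]
      congr 1
      omega
    rw [this]
    exact append_mem_kstar (mem_star_of_mem h0) (mem_star_of_mem hp)
  -- With `w = 1 0^(2k)`, the word `0^j w` factors as `0^j 1 0^(k-j)`, then `0^(k+1)`, then
  -- `0^(j-1)`.
  obtain ⟨x, hx⟩ := exists_of_shift_down (p := k + 1) hw
    fun j h1 h2 => ⟨zerosOneZeros j (k - j) ++ zeros (k + 1),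
      append_mem_kstar (mem_star_of_mem (hj j h1 (by omega))) (mem_star_of_mem hp), by
      rw [zeros_append_zerosOneZeros, zerosOneZeros_append_zeros, zerosOneZeros_append_zeros]
      congr 1
      omega⟩
  exact hZ.exists_reset hne k.succ_pos (mem_star_of_mem hp) hx

/-! ### Codes of every size `d ≥ 3` with a reset word -/

/-- The words of length `k` with at most one `1`, except `1 0 ^ (k - 1)`. -/
def sparseWords (k : ℕ) : Finset (List (Fin 2)) :=
  insert (zeros k) ((Ico 1 k).image fun j => zerosOneZeros j (k - 1 - j))

theorem zeros_mem_sparseWords (k : ℕ) : zeros k ∈ sparseWords k := mem_insert_self _ _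

theorem zerosOneZeros_mem_sparseWords {j k : ℕ} (h1 : 1 ≤ j) (h2 : j < k) :
    zerosOneZeros j (k - 1 - j) ∈ sparseWords k :=
  mem_insert_of_mem (mem_image_of_mem _ (mem_Ico.2 ⟨h1, h2⟩))

theorem card_sparseWords_le {k : ℕ} (hk : 0 < k) : (sparseWords k).card ≤ k := by
  have h1 := card_insert_le (zeros k) ((Ico 1 k).image fun j => zerosOneZeros j (k - 1 - j))
  have h2 := card_image_le (s := Ico 1 k) (f := fun j => zerosOneZeros j (k - 1 - j))
  rw [Nat.card_Ico] at h2
  rw [sparseWords]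
  omega

theorem sparseWords_subset (k : ℕ) : sparseWords k ⊆ wordsOfLength k := by
  intro w hw
  rw [mem_wordsOfLength]
  rcases mem_insert.1 hw with rfl | hw
  · simp
  · obtain ⟨j, hj, rfl⟩ := mem_image.1 hw
    have := mem_Ico.1 hj
    rw [length_zerosOneZeros]
    omega

theorem zerosOneZeros_zero_notMem_sparseWords (k l : ℕ) :
    zerosOneZeros 0 l ∉ sparseWords k := by
  intro hw
  rcases mem_insert.1 hw with h | hw
  · exact zeros_ne_zerosOneZeros _ _ _ h.symm
  · obtain ⟨j, hj, h⟩ := mem_image.1 hw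
    exact zerosOneZeros_zero_ne (mem_Ico.1 hj).1 h.symm

theorem zerosOneZeros_zero_mem_wordsOfLength {k : ℕ} (hk : 0 < k) :
    zerosOneZeros 0 (k - 1) ∈ wordsOfLength k := by
  rw [mem_wordsOfLength, length_zerosOneZeros]
  omega

theorem length_of_mem_split_wordsOfLength {k : ℕ} {T : Finset (List (Fin 2))}
    (hT : T ⊆ wordsOfLength k) {w : List (Fin 2)} (hw : w ∈ split (wordsOfLength k) T) :
    k ≤ w.length ∧ w.length ≤ k + 1 := by
  rcases mem_split.1 hw with ⟨h, -⟩ | ⟨t, ht, b, rfl⟩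
  · rw [mem_wordsOfLength.1 h]
    omega
  · simp [mem_wordsOfLength.1 (hT ht)]

theorem nil_notMem_split_wordsOfLength {k : ℕ} (hk : 0 < k) {T : Finset (List (Fin 2))}
    (hT : T ⊆ wordsOfLength k) : [] ∉ split (wordsOfLength k) T := fun h => by
  have := (length_of_mem_split_wordsOfLength hT h).1
  simp at this
  omega

/-- The sparse words stay unsplit and `1 0^(k-1)` is split, so `1 0^k` is a codeword and zeros have
period `k`: the upward shift with `p = l = k`. The remaining split words are arbitrary, and `m + k ≤
2^k` leaves enough of them. -/
theorem exists_code_of_few_splits {k m : ℕ} (hk : 0 < k) (hm : 0 < m) (hmk : m + k ≤ 2 ^ k) :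
    ∃ Z, IsMaximalPrefixCode Z ∧ Z.card = 2 ^ k + m ∧
      (∀ z ∈ Z, k ≤ z.length ∧ z.length ≤ k + 1) ∧ ∃ t ∈ star Z, ∀ r, r ++ t ∈ star Z := by
  have hsub : {zerosOneZeros 0 (k - 1)} ⊆ wordsOfLength k \ sparseWords k :=
    singleton_subset_iff.2 (mem_sdiff.2 ⟨zerosOneZeros_zero_mem_wordsOfLength hk,
      zerosOneZeros_zero_notMem_sparseWords _ _⟩)
  obtain ⟨T, h1, h2, rfl⟩ := exists_subsuperset_card_eq (n := m) hsub (by simpa using Nat.succ_le_of_lt hm) (by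
    rw [card_sdiff_of_subset (sparseWords_subset k), card_wordsOfLength]
    have := card_sparseWords_le hk
    omega)
  have hT : T ⊆ wordsOfLength k := h2.trans sdiff_subset
  have hW := isMaximalPrefixCode_wordsOfLength k
  have hmem : ∀ w ∈ sparseWords k, w ∈ split (wordsOfLength k) T := fun w hw =>
    mem_split.2 (Or.inl ⟨sparseWords_subset k hw, fun h => (mem_sdiff.1 (h2 h)).2 hw⟩)
  refine ⟨_, hW.split hT, by rw [hW.card_split hT, card_wordsOfLength],
    fun z hz => length_of_mem_split_wordsOfLength hT hz, ?_⟩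
  refine (hW.split hT).exists_reset_of_long (nil_notMem_split_wordsOfLength hk hT) hk le_rfl
    (hmem _ (zeros_mem_sparseWords k)) (mem_split.2 (Or.inr ⟨_, singleton_subset_iff.1 h1, 0, ?_⟩))
    fun j hj1 hj2 => hmem _ (zerosOneZeros_mem_sparseWords hj1 hj2)
  have := zerosOneZeros_append_zeros 0 (k - 1) 1
  rwa [Nat.sub_add_cancel hk] at this

/-- The opposite choice: all sparse words are split and `1 0^(k-1)` is kept, so zeros have period `k
+ 1` and the downward shift applies. -/
theorem exists_code_of_many_splits {k m : ℕ} (hk : 0 < k) (hm : k ≤ m) (hmk : m < 2 ^ k) :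
    ∃ Z, IsMaximalPrefixCode Z ∧ Z.card = 2 ^ k + m ∧
      (∀ z ∈ Z, k ≤ z.length ∧ z.length ≤ k + 1) ∧ ∃ t ∈ star Z, ∀ r, r ++ t ∈ star Z := by
  have hsub : sparseWords k ⊆ (wordsOfLength k).erase (zerosOneZeros 0 (k - 1)) :=
    subset_erase.2 ⟨sparseWords_subset k, zerosOneZeros_zero_notMem_sparseWords _ _⟩
  obtain ⟨T, h1, h2, rfl⟩ := exists_subsuperset_card_eq hsub ((card_sparseWords_le hk).trans hm) (by
    rw [card_erase_of_mem (zerosOneZeros_zero_mem_wordsOfLength hk), card_wordsOfLength]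
    omega)
  have hT : T ⊆ wordsOfLength k := h2.trans (erase_subset _ _)
  have hW := isMaximalPrefixCode_wordsOfLength k
  have hmem : ∀ w ∈ sparseWords k, w ++ zeros 1 ∈ split (wordsOfLength k) T := fun w hw =>
    mem_split.2 (Or.inr ⟨w, h1 hw, 0, rfl⟩)
  refine ⟨_, hW.split hT, by rw [hW.card_split hT, card_wordsOfLength],
    fun z hz => length_of_mem_split_wordsOfLength hT hz, ?_⟩
  refine (hW.split hT).exists_reset_of_short (nil_notMem_split_wordsOfLength hk hT) hk
    (by simpa only [zeros_append] using hmem _ (zeros_mem_sparseWords k))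
    (mem_split.2 (Or.inl ⟨zerosOneZeros_zero_mem_wordsOfLength hk,
      fun h => notMem_erase _ _ (h2 h)⟩)) fun j hj1 hj2 => ?_
  -- For `j = k` the codeword `0^k 1` comes from splitting `0^k`; for `j < k` a sparse word is
  -- extended by `0`.
  rcases hj2.eq_or_lt with rfl | hj2
  · exact mem_split.2 (Or.inr ⟨zeros j, h1 (zeros_mem_sparseWords j), 1, by
      simp [zerosOneZeros, zeros]⟩)
  · have := hmem _ (zerosOneZeros_mem_sparseWords hj1 hj2)
    rw [zerosOneZeros_append_zeros] at this
    convert this using 2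
    omega

/-- Splitting every word of length `k` except `0^k` gives `2^(k+1) - 1` words, and splitting `1 0^k`
supplies the last one. Then zeros have period `k` and `1 0^(k+1)` is a codeword: the upward shift
with `p = k`, `l = k + 1`. -/
theorem exists_code_of_power {k : ℕ} (hk : 0 < k) :
    ∃ Z, IsMaximalPrefixCode Z ∧ Z.card = 2 ^ (k + 1) ∧
      (∀ z ∈ Z, k ≤ z.length ∧ z.length ≤ k + 2) ∧ ∃ t ∈ star Z, ∀ r, r ++ t ∈ star Z := by
  have hW := isMaximalPrefixCode_wordsOfLength k
  have hz : zeros k ∈ wordsOfLength k := mem_wordsOfLength.2 (by simp)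
  set T := (wordsOfLength k).erase (zeros k) with hTdef
  have hT : T ⊆ wordsOfLength k := erase_subset _ _
  have hmem : ∀ i j, i + j + 1 = k → zerosOneZeros i (j + 1) ∈ split (wordsOfLength k) T :=
    fun i j h => mem_split.2 (Or.inr ⟨zerosOneZeros i j,
      mem_erase.2 ⟨(zeros_ne_zerosOneZeros _ _ _).symm,
        mem_wordsOfLength.2 (by rw [length_zerosOneZeros, h])⟩, 0,
      zerosOneZeros_append_zeros i j 1⟩)
  have hS : {zerosOneZeros 0 k} ⊆ split (wordsOfLength k) T := by
    have := hmem 0 (k - 1) (by omega)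
    rw [Nat.sub_add_cancel hk] at this
    exact singleton_subset_iff.2 this
  have hpow := Nat.one_le_two_pow (n := k)
  refine ⟨_, (hW.split hT).split hS, ?_, fun w hw => ?_, ?_⟩
  · rw [(hW.split hT).card_split hS, hW.card_split hT, card_singleton, hTdef,
      card_erase_of_mem hz, card_wordsOfLength, pow_succ]
    omega
  · rcases mem_split.1 hw with ⟨h, -⟩ | ⟨t, ht, b, rfl⟩
    · have := length_of_mem_split_wordsOfLength hT h
      omega
    · rw [mem_singleton.1 ht, List.length_append, length_zerosOneZeros, List.length_singleton]
      omega
  · refine ((hW.split hT).split hS).exists_reset_of_long (p := k) (l := k + 1) (fun h => ?_) hk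
      k.le_succ ?_ ?_ fun j h1 h2 => ?_
    · rcases mem_split.1 h with ⟨h, -⟩ | ⟨t, -, b, h⟩
      · exact nil_notMem_split_wordsOfLength hk hT h
      · simp at h
    · exact mem_split.2 (Or.inl ⟨mem_split.2 (Or.inl ⟨hz, notMem_erase _ _⟩),
        fun h => zeros_ne_zerosOneZeros _ _ _ (mem_singleton.1 h)⟩)
    · exact mem_split.2 (Or.inr ⟨_, mem_singleton_self _, 0, zerosOneZeros_append_zeros 0 k 1⟩)
    · have := hmem j (k - 1 - j) (by omega)
      rw [show k - 1 - j + 1 = k + 1 - 1 - j by omega] at this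
      exact mem_split.2 (Or.inl ⟨this,
        fun h => zerosOneZeros_zero_ne h1 (mem_singleton.1 h).symm⟩)

theorem exists_code {d : ℕ} (hd : 3 ≤ d) :
    ∃ Z, IsMaximalPrefixCode Z ∧ Z.card = d ∧
      (∀ z ∈ Z, Nat.log 2 (d - 1) ≤ z.length ∧ z.length ≤ Nat.clog 2 (d + 1)) ∧
      ∃ t ∈ star Z, ∀ r, r ++ t ∈ star Z := by
  obtain ⟨k, hk1, hk2⟩ : ∃ k, 2 ^ k ≤ d ∧ d < 2 ^ (k + 1) :=
    ⟨Nat.log 2 d, Nat.pow_log_le_self 2 (by omega), Nat.lt_pow_succ_log_self one_lt_two d⟩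
  have hclog : k + 1 ≤ Nat.clog 2 (d + 1) :=
    (Nat.lt_clog_iff_pow_lt one_lt_two).2 (by omega)
  have hk : 0 < k := by
    rcases Nat.eq_zero_or_pos k with rfl | h
    · omega
    · exact h
  rcases hk1.eq_or_lt with hdk | hdk
  · obtain ⟨k, rfl⟩ : ∃ j, k = j + 1 := ⟨k - 1, by omega⟩
    have hk0 : 0 < k := by
      rcases Nat.eq_zero_or_pos k with rfl | h
      · omega
      · exact h
    have hlog : Nat.log 2 (d - 1) ≤ k :=
      Nat.lt_succ_iff.1 (Nat.log_lt_of_lt_pow (by omega) (by omega))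
    obtain ⟨Z, h1, h2, h3, h4⟩ := exists_code_of_power hk0
    refine ⟨Z, h1, h2.trans hdk, fun z hz => ?_, h4⟩
    have := h3 z hz
    omega
  · have hlog : Nat.log 2 (d - 1) ≤ k :=
      Nat.lt_succ_iff.1 (Nat.log_lt_of_lt_pow (by omega) (by omega))
    have hex : ∃ Z, IsMaximalPrefixCode Z ∧ Z.card = 2 ^ k + (d - 2 ^ k) ∧
        (∀ z ∈ Z, k ≤ z.length ∧ z.length ≤ k + 1) ∧ ∃ t ∈ star Z, ∀ r, r ++ t ∈ star Z := by
      by_cases hm : k ≤ d - 2 ^ k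
      · exact exists_code_of_many_splits hk hm (by rw [pow_succ] at hk2; omega)
      -- When `m = d - 2^k < k`, this gives `m + k ≤ 2^k`, so the two split constructions cover all
      -- cases.
      · have h2k : 2 * k ≤ 2 ^ k := by
          obtain ⟨k, rfl⟩ : ∃ j, k = j + 1 := ⟨k - 1, by omega⟩
          have := Nat.lt_two_pow_self (n := k)
          rw [pow_succ]
          omega
        exact exists_code_of_few_splits hk (by omega) (by omega)
    obtain ⟨Z, h1, h2, h3, h4⟩ := hex
    refine ⟨Z, h1, by omega, fun z hz => ?_, h4⟩
    have := h3 z hz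
    omega

/-! ### From the code to the encoding -/

theorem mem_star_iff_of_range {A : Type} {Z : Finset (List (Fin 2))} {φ : A → List (Fin 2)}
    (hφ : Set.range φ = Z) {w : List (Fin 2)} :
    w ∈ star Z ↔ ∃ t : List A, w = t.flatMap φ := by
  constructor
  · intro hw
    obtain ⟨K, rfl, hK⟩ := Language.mem_kstar.1 hw
    induction K with
    | nil => exact ⟨[], rfl⟩
    | cons y K ih =>
      have hK' : ∀ z ∈ K, z ∈ ((Z : Set (List (Fin 2))) : Language (Fin 2)) :=
        fun z hz => hK z (List.mem_cons_of_mem _ hz)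
      obtain ⟨t, ht⟩ := ih hK' (Language.mem_kstar.2 ⟨K, rfl, hK'⟩)
      have hy : y ∈ Set.range φ := hφ ▸ hK y List.mem_cons_self
      obtain ⟨a, rfl⟩ := hy
      exact ⟨a :: t, by simp [ht]⟩
  · rintro ⟨t, rfl⟩
    induction t with
    | nil => exact Language.nil_mem_kstar _
    | cons a t ih =>
      have ha : φ a ∈ (Z : Set (List (Fin 2))) := hφ ▸ Set.mem_range_self a
      exact append_mem_kstar (mem_star_of_mem (mem_coe.1 ha)) ih

theorem exists_encoding {d : ℕ} (hd : 3 ≤ d) :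
    ∃ φ : Fin d → List (Fin 2), IsPrefixEncoding φ ∧ IsRightComplete φ ∧ HasResetWord φ ∧
      (∀ a, Nat.log 2 (d - 1) ≤ (φ a).length) ∧ ∀ a, (φ a).length ≤ Nat.clog 2 (d + 1) := by
  obtain ⟨Z, hZ, hcard, hlen, t, ht, hreset⟩ := exists_code hd
  let e : Fin d ≃ Z := (Z.equivFinOfCardEq hcard).symm
  let φ : Fin d → List (Fin 2) := fun a => (e a : List (Fin 2))
  have hmem : ∀ a, φ a ∈ Z := fun a => (e a).2
  have hrange : Set.range φ = Z := by
    ext w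
    constructor
    · rintro ⟨a, rfl⟩
      exact hmem a
    · exact fun hw => ⟨e.symm ⟨w, hw⟩, by simp [φ]⟩
  have hlog : 0 < Nat.log 2 (d - 1) := Nat.log_pos one_lt_two (by omega)
  have hne : [] ∉ Z := fun h => by
    have := (hlen _ h).1
    simp only [List.length_nil] at this
    omega
  refine ⟨φ, ⟨fun a b hab => ?_, fun a h => hne (h ▸ hmem a)⟩, fun w => ?_, ?_,
    fun a => (hlen _ (hmem a)).1, fun a => (hlen _ (hmem a)).2⟩
  · exact e.injective (Subtype.ext (hZ.eq_of_prefix _ (hmem a) _ (hmem b) hab))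
  · obtain ⟨s, hs⟩ := hZ.exists_append_mem_star hne w
    exact ⟨s, (mem_star_iff_of_range hrange).1 hs⟩
  · obtain ⟨t, rfl⟩ := (mem_star_iff_of_range hrange).1 ht
    exact ⟨t, fun r => (mem_star_iff_of_range hrange).1 (hreset r)⟩

end MaximalPrefixCodes

end PrefixEncoding

/-! ### The bound -/

theorem proposition4p5 (L : LanguageClass)
    (hL : L = finiteCompleteLanguages ∨ L = finiteCompleteCodes ∨ L = finiteCompletePrefixCodes)
    (n d : ℕ) (hn : 0 < n) (hd : 3 ≤ d) :
    syncC L n d ≤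
      ⌈(syncC L (⌈Real.logb 2 ((d : ℝ) + 1)⌉₊ * n) 2 : ℝ) /
        (⌊Real.logb 2 ((d : ℝ) - 1)⌋₊ : ℝ)⌉₊ := by
  have hceil : ⌈Real.logb 2 ((d : ℝ) + 1)⌉₊ = Nat.clog 2 (d + 1) := by
    have := Real.natCeil_logb_natCast 2 (d + 1)
    push_cast at this
    exact this
  have hfloor : ⌊Real.logb 2 ((d : ℝ) - 1)⌋₊ = Nat.log 2 (d - 1) := by
    have := Real.natFloor_logb_natCast 2 (d - 1)
    rw [Nat.cast_sub (by omega)] at this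
    push_cast at this
    exact this
  rw [hceil, hfloor]
  obtain ⟨φ, hφ, hc, hr, hmin, hmax⟩ := PrefixEncoding.exists_encoding hd
  obtain ⟨hpos, hbound⟩ := (syncC_isLeast L (Nat.clog 2 (d + 1) * n) 2).1
  have hlog : (0 : ℝ) < (Nat.log 2 (d - 1) : ℝ) :=
    Nat.cast_pos.2 (Nat.log_pos one_lt_two (by omega))
  -- By minimality it suffices that the ceiling is itself a valid bound. It is positive because the
  -- binary constant is, and `d ≥ 3` makes the logarithm at least 1.
  refine (syncC_isLeast L n d).2 ⟨Nat.ceil_pos.2 (div_pos (Nat.cast_pos.2 hpos) hlog), ?_⟩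
  intro X hX hs hsize
  obtain ⟨hcX, hY⟩ := hφ.encode_mem_class hc hL hX
  obtain ⟨u, v, huv, hlen⟩ := hbound _ hY (hφ.isSynchronizing_encode hr hcX hs)
    (PrefixEncoding.langSize_encode_le hmax hsize)
  obtain ⟨u', v', huv', rfl, rfl⟩ := hφ.exists_isSyncPair huv
  refine ⟨u', v', huv', ?_⟩
  rw [← List.flatMap_append] at hlen
  have h := (PrefixEncoding.le_length_flatMap hmin (u' ++ v')).trans hlen
  have h' : ((u' ++ v').length : ℝ) ≤
      (syncC L (Nat.clog 2 (d + 1) * n) 2 : ℝ) / (Nat.log 2 (d - 1) : ℝ) := by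
    rw [le_div_iff₀ hlog, mul_comm]
    exact_mod_cast h
  exact_mod_cast h'.trans (Nat.le_ceil _)
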